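/- Consider an $n$-player general-sum normal-form game ($n\ge 1$) in which every player has $d\ge 2$ deterministic strategies and utilities $\mathcal U_i:[d]^n\to[-1,1]$; let $\nu_i(x)=\mathbb E_{s\sim x}[\mathcal U_i(s)]$ be the multilinear extension to mixed strategy profiles $x=(x_1,\dots,x_n)$. For $L>0$ the game is called $L$-smooth if $\|\nabla_{x_i}\nu_i(x)-\nabla_{x_i}\nu_i(x')\|_\infty\le L\sum_j\|x_j-x_j'\|_1$ for all players $i$ and all mixed profiles $x,x'$. **DLRC-OMWU** with parameters $\eta,\alpha,\beta$: each player starts with $U^1=u^0=0\in\mathbb R^d$. In round $t=1,2,\dots$ it sets $r^t=U^t+u^{t-1}$; sets $\lambda^t=\eta$ if $\max_k r^t[k]\ge-\beta\log^2 d$, and otherwise $$\lambda^t=\operatorname*{arg\,max}_{\lambda\in(0,\eta]}\Big\{\log\Big(\sum_{k=1}^d e^{\lambda r^t[k]}\Big)+(\alpha-1)\log\lambda\Big\};$$ plays $x^t[k]=e^{\lambda^t r^t[k]}/\sum_{k'}e^{\lambda^t r^t[k']}$; observes a utility vector $\nu^t\in\mathbb R^d$; and sets $u^t=\nu^t-\langle\nu^t,x^t\rangle\mathbf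 1$, $U^{t+1}=U^t+u^t$. In self-play all players run this simultaneously, and player $i$ observes $\nu_i^t=\nabla_{x_i}\nu_i(x_1^t,\dots,x_n^t)$. A distribution $\sigma$ on $[d]^n$ is an $\epsilon$-approximate coarse correlated equilibrium (CCE) if $\mathbb E_{s\sim\sigma}[\mathcal U_i(s)]\ge\mathbb E_{s\sim\sigma}[\mathcal U_i(a,s_{-i})]-\epsilon$ for every player $i$ and every $a\in[d]$. **Statement.** For every $\beta\ge 70$ there is a constant $C>0$, depending only on $\beta$, such that for all $n\ge1$, $d\ge2$ and every game as above: the game is $1$-smooth; and for every $L>0$ for which the game is $L$-smooth, if all players run DLRC-OMWU with $\eta=\min\{\tfrac1{50},\tfrac1{12\sqrt2\,Ln}\}$ and $\alpha=2+2\log d+\beta\log^2 d$, then for every $T\ge2$ the empirical distribution of play $\sigma=\frac1T\sum_{t=1}^T x_1^t\times\cdots\times x_n^t$ is an $\epsilon$-approximate CCE with $$\epsilon=C\,\max\{1,L\}\,\frac{n\log^2 d\,\log T}{T}.$$ In particular, with $L=1$ (always admissible), or any admissible $L\le1$, $\sigma$ is an $O\big(\frac{n\log^2 d\log T}{T}\big)$-approximate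 CCE with a constant depending only on $\beta$. -/

import Mathlib

/-- An `n`-player general-sum normal-form game with `d` deterministic strategies per player:
`utility i s` is the payoff of player `i` under the joint deterministic strategy `s`. -/
structure NormalFormGame (n d : ℕ) where
  utility : Fin n → (Fin n → Fin d) → ℝ

namespace NormalFormGame

variable {n d : ℕ}

/-- The multilinear extension `ν_i(x) = E_{s ∼ x}[U_i(s)]`, where `s_1, …, s_n` are drawn
independently from `x_1, …, x_n`. -/
def expectedUtility (G : NormalFormGame n d) (i : Fin n) (x : Fin n → Fin d → ℝ) : ℝ :=
  ∑ s : Fin n → Fin d, (∏ j, x j (s j)) * G.utility i s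

/-- The gradient `∇_{x_i} ν_i(x)`. Since `ν_i` is linear in `x_i`, its coordinate `a` is the value
of `ν_i` when `x_i` is replaced by the vertex `e_a`. -/
def utilityGradient (G : NormalFormGame n d) (i : Fin n) (x : Fin n → Fin d → ℝ) : Fin d → ℝ :=
  fun a => G.expectedUtility i (Function.update x i (Pi.single a 1))

/-- All utilities lie in `[-1, 1]`. -/
def IsBounded (G : NormalFormGame n d) : Prop :=
  ∀ i s, |G.utility i s| ≤ 1

/-- `‖∇_{x_i} ν_i(x) - ∇_{x_i} ν_i(x')‖_∞ ≤ L ∑_j ‖x_j - x'_j‖_1` for all mixed strategy profiles;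
the norm on `Fin d → ℝ` is the sup norm. -/
def IsSmooth (G : NormalFormGame n d) (L : ℝ) : Prop :=
  ∀ (i : Fin n) (x x' : Fin n → Fin d → ℝ),
    (∀ j, x j ∈ stdSimplex ℝ (Fin d)) → (∀ j, x' j ∈ stdSimplex ℝ (Fin d)) →
      ‖G.utilityGradient i x - G.utilityGradient i x'‖ ≤ L * ∑ j, ∑ k, |x j k - x' j k|

/-- `σ` is a probability distribution on joint deterministic strategies, and no unilateral deviation
of a player to a fixed strategy `a` gains more than `ε` in expectation. -/
def IsApproxCCE (G : NormalFormGame n d) (ε : ℝ) (σ : (Fin n → Fin d) → ℝ) : Prop :=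
  σ ∈ stdSimplex ℝ (Fin n → Fin d) ∧
    ∀ (i : Fin n) (a : Fin d),
      ∑ s, σ s * G.utility i s ≥ ∑ s, σ s * G.utility i (Function.update s i a) - ε

end NormalFormGame

namespace DLRC

/-- The learning rate control objective
`f(l; r) = log (∑_k exp (l r_k)) + (α - 1) log l`. -/
noncomputable def rateObjective {d : ℕ} (α : ℝ) (r : Fin d → ℝ) (l : ℝ) : ℝ :=
  Real.log (∑ k, Real.exp (l * r k)) + (α - 1) * Real.log l

/-- `l` is a maximizer of the learning rate control objective over `(0, η]`. -/
def IsOptimalRate {d : ℕ} (η α : ℝ) (r : Fin d → ℝ) (l : ℝ) : Prop :=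
  l ∈ Set.Ioc 0 η ∧ IsMaxOn (rateObjective α r) (Set.Ioc 0 η) l

/-- The maximum is attained, so the choice of a maximizer below is meaningful. -/
theorem exists_isOptimalRate {d : ℕ} (hd : 1 ≤ d) {η α : ℝ} (hη : 0 < η) (hα : 1 < α)
    (r : Fin d → ℝ) : ∃ l, IsOptimalRate η α r l := by
  have : Nonempty (Fin d) := ⟨⟨0, hd⟩⟩
  have hS : ∀ l : ℝ, 0 < ∑ k, Real.exp (l * r k) := fun l =>
    Finset.sum_pos (fun k _ => Real.exp_pos _) Finset.univ_nonempty
  have hc : ContinuousOn (fun l : ℝ => l ^ (α - 1) * ∑ k, Real.exp (l * r k))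
      (Set.Icc 0 η) := by
    apply ContinuousOn.mul
    · exact continuousOn_id.rpow_const (fun _ _ => Or.inr (by linarith))
    · fun_prop
  obtain ⟨l, hl, hmax⟩ := isCompact_Icc.exists_isMaxOn ⟨η, hη.le, le_refl η⟩ hc
  have hpos : ∀ m : ℝ, 0 < m → 0 < m ^ (α - 1) * ∑ k, Real.exp (m * r k) := fun m hm =>
    mul_pos (Real.rpow_pos_of_pos hm _) (hS m)
  have hlog : ∀ m : ℝ, 0 < m →
      rateObjective α r m = Real.log (m ^ (α - 1) * ∑ k, Real.exp (m * r k)) := by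
    intro m hm
    rw [Real.log_mul (Real.rpow_pos_of_pos hm _).ne' (hS m).ne', Real.log_rpow hm, rateObjective]
    ring
  have hl0 : 0 < l := by
    rcases hl.1.lt_or_eq with h | h
    · exact h
    · exfalso
      have h1 := hmax (show η ∈ Set.Icc 0 η from ⟨hη.le, le_refl η⟩)
      have h2 := hpos η hη
      simp only [Set.mem_ofPred_eq, ← h] at h1
      rw [Real.zero_rpow (by linarith), zero_mul] at h1
      linarith
  refine ⟨l, ⟨hl0, hl.2⟩, fun m hm => ?_⟩
  simp only [Set.mem_ofPred_eq]
  rw [hlog m hm.1, hlog l hl0]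
  exact Real.log_le_log (hpos m hm.1) (hmax ⟨hm.1.le, hm.2⟩)

open Classical in
/-- The learning rate: `η` when `max_k r_k ≥ -β log² d`, and otherwise the maximizer of the
learning rate control objective over `(0, η]`. -/
noncomputable def learningRate {d : ℕ} (η α β : ℝ) (r : Fin d → ℝ) : ℝ :=
  if ∃ k, r k ≥ -β * Real.log d ^ 2 then η
  else Classical.epsilon (IsOptimalRate η α r)

/-- What one learner remembers at the beginning of a round `t`: the accumulated corrected utilities
`cumulative = U^t = ∑_{τ < t} u^τ` and the most recent one, `last = u^{t-1}`. -/
structure LearnerState (d : ℕ) where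
  cumulative : Fin d → ℝ
  last : Fin d → ℝ

namespace LearnerState

variable {d : ℕ}

/-- The state before the first round. -/
def initial : LearnerState d := ⟨0, 0⟩

/-- The optimistic regret vector `r^t = U^t + u^{t-1}`. -/
def regret (S : LearnerState d) : Fin d → ℝ := S.cumulative + S.last

/-- The mixed strategy `x^t` played in this state: the softmax of `λ^t r^t`. -/
noncomputable def strategy (η α β : ℝ) (S : LearnerState d) : Fin d → ℝ := fun k =>
  Real.exp (learningRate η α β S.regret * S.regret k) /
    ∑ k', Real.exp (learningRate η α β S.regret * S.regret k')

/-- The corrected utility `u^t = ν^t - ⟨ν^t, x^t⟩ 1` after observing the utility vector `v = ν^t`. -/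
noncomputable def correctedUtility (η α β : ℝ) (S : LearnerState d) (v : Fin d → ℝ) : Fin d → ℝ :=
  fun k => v k - ∑ k', v k' * S.strategy η α β k'

/-- The state after observing the utility vector `v`. -/
noncomputable def observe (η α β : ℝ) (S : LearnerState d) (v : Fin d → ℝ) : LearnerState d :=
  ⟨S.cumulative + S.correctedUtility η α β v, S.correctedUtility η α β v⟩

end LearnerState

/-- Self-play: the states of all players after `t` rounds, when each player runs DLRC-OMWU and in
each round observes only the gradient of its own expected utility at the joint play. -/
noncomputable def selfPlay {n d : ℕ} (G : NormalFormGame n d) (η α β : ℝ) :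
    ℕ → Fin n → LearnerState d
  | 0 => fun _ => LearnerState.initial
  | t + 1 => fun i =>
      (selfPlay G η α β t i).observe η α β
        (G.utilityGradient i (fun j => (selfPlay G η α β t j).strategy η α β))

/-- The mixed strategy profile played in round `t + 1` of self-play. -/
noncomputable def play {n d : ℕ} (G : NormalFormGame n d) (η α β : ℝ) (t : ℕ) :
    Fin n → Fin d → ℝ :=
  fun j => (selfPlay G η α β t j).strategy η α β

/-- The empirical distribution of play over the first `T` rounds: the average of the product
distributions `x_1^t × ⋯ × x_n^t`. -/
noncomputable def empiricalPlay {n d : ℕ} (G : NormalFormGame n d) (η α β : ℝ) (T : ℕ) :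
    (Fin n → Fin d) → ℝ :=
  fun s => (1 / (T : ℝ)) * ∑ t ∈ Finset.range T, ∏ j, play G η α β t j (s j)

/-- The step-size cap `η = min {1/50, 1/(12 √2 L n)}`. -/
noncomputable def eta (L : ℝ) (n : ℕ) : ℝ := min (1 / 50) (1 / (12 * Real.sqrt 2 * L * n))

/-- The parameter `α = 2 + 2 log d + β log² d`. -/
noncomputable def alpha (β : ℝ) (d : ℕ) : ℝ := 2 + 2 * Real.log d + β * Real.log d ^ 2

end DLRC

/-! Let Φ(r) be the maximum over λ in (0, η] of log ∑ exp(λ r_k) + (α-1) log λ. The rate played is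
always a maximizer, even in the branch that sets it to η (`isOptimalRate_cap`). By the envelope
principle λ·softmax(λ r) then acts as the gradient of Φ at r, so the algorithm is an optimistic
potential method for Φ, and everything reduces to the Bregman divergence `rateBregman` of Φ.

Two estimates on this divergence carry the proof. It dominates the squared ℓ₁ distance of the
strategies (`sq_dist_softmax_le_rateBregman`), and its symmetrization is O(η² w²) when the regret
vectors differ by at most w in each coordinate (`rateBregman_add_swap_le`). Both follow from
Pinsker's inequality at a fixed rate together with control of rate changes. For the latter, the
variance of log-probabilities is at most 1 + log² d, so log-sum-exp becomes concave along rays after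
adding V log λ with V = 1 + log² d. Since α exceeds V by a large factor, enough logarithmic
concavity remains in the objective.

Corrected utilities are orthogonal to the strategy played, so each increment of Φ along the
cumulative vectors is a difference of two divergences. Telescoping bounds Φ by the variation of the
utilities minus the squared movement of the strategies (`potential_le`).

In self-play, smoothness bounds the variation by the movement of all players. Regrets may be
negative, but Φ cannot be very negative: the rate η/(T+1) shows that it falls below (α-1) log η by
at most (α-1) log(T+1) + 2η. Summing over players, with η of order 1/(Ln), bounds the total movement
(`sum_movement_le`). Reinserting this for one player bounds each regret (`cumulative_le`), and
average regret is the CCE gap. -/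

/-! ### Softmax, log-sum-exp and Pinsker's inequality. -/

/-- The softmax distribution with weights proportional to `exp (r k)`. -/
noncomputable def softmax {ι : Type*} [Fintype ι] (r : ι → ℝ) : ι → ℝ :=
  fun k => Real.exp (r k) / ∑ k', Real.exp (r k')

/-- The log-sum-exp function. -/
noncomputable def logSumExp {ι : Type*} [Fintype ι] (r : ι → ℝ) : ℝ :=
  Real.log (∑ k, Real.exp (r k))

/-- A rational lower bound for the logarithm, tight to third order at `1`. -/
theorem div_le_mul_log {x : ℝ} (hx : 0 < x) :
    3 * (x - 1) ^ 2 / (2 * x + 4) ≤ x * Real.log x - x + 1 := by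
  -- This is the claim divided by `y`. The derivative of `g` has the sign of `(y - 1) ^ 3`, so `g`
  -- is minimal at `1`, where it vanishes.
  let g : ℝ → ℝ := fun y => Real.log y - (y - 1) * (5 * y + 1) / (2 * y ^ 2 + 4 * y)
  have hg : ∀ y, 0 < y → HasDerivAt g (4 * (y - 1) ^ 3 / (2 * y ^ 2 + 4 * y) ^ 2) y := by
    intro y hy
    have h0 : (2 * y ^ 2 + 4 * y) ≠ 0 := by positivity
    have h1 : HasDerivAt (fun y : ℝ => (y - 1) * (5 * y + 1)) (10 * y - 4) y := by
      have := ((hasDerivAt_id y).sub_const 1).mul (((hasDerivAt_id y).const_mul 5).add_const 1)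
      refine this.congr_deriv ?_
      simp only [id]
      ring
    have h2 : HasDerivAt (fun y : ℝ => 2 * y ^ 2 + 4 * y) (4 * y + 4) y := by
      have := ((hasDerivAt_pow 2 y).const_mul 2).add ((hasDerivAt_id y).const_mul 4)
      refine this.congr_deriv ?_
      norm_num
      ring
    have h3 := (Real.hasDerivAt_log hy.ne').sub (h1.div h2 h0)
    refine h3.congr_deriv ?_
    field_simp
    ring
  have hmin : 0 ≤ g x := by
    have hg1 : g 1 = 0 := by simp [g]
    rw [← hg1]
    rcases le_total x 1 with h | h
    · have : AntitoneOn g (Set.Icc x 1) := by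
        apply antitoneOn_of_deriv_nonpos (convex_Icc _ _)
        · exact fun y hy => (hg y (hx.trans_le hy.1)).continuousAt.continuousWithinAt
        · rw [interior_Icc]
          exact fun y hy => (hg y (hx.trans hy.1)).differentiableAt.differentiableWithinAt
        · rw [interior_Icc]
          intro y hy
          rw [(hg y (hx.trans hy.1)).deriv]
          apply div_nonpos_of_nonpos_of_nonneg _ (sq_nonneg _)
          have : (y - 1) ^ 3 ≤ 0 := Odd.pow_nonpos (by decide) (by linarith [hy.2])
          linarith
      exact this ⟨le_rfl, h⟩ ⟨h, le_rfl⟩ h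
    · have : MonotoneOn g (Set.Icc 1 x) := by
        apply monotoneOn_of_deriv_nonneg (convex_Icc _ _)
        · exact fun y hy => (hg y (one_pos.trans_le hy.1)).continuousAt.continuousWithinAt
        · rw [interior_Icc]
          exact fun y hy => (hg y (one_pos.trans hy.1)).differentiableAt.differentiableWithinAt
        · rw [interior_Icc]
          intro y hy
          rw [(hg y (one_pos.trans hy.1)).deriv]
          have : 0 ≤ (y - 1) ^ 3 := pow_nonneg (by linarith [hy.1]) 3
          positivity
      exact this ⟨le_rfl, h⟩ ⟨h, le_rfl⟩ h
  have h1 : (x - 1) * (5 * x + 1) / (2 * x ^ 2 + 4 * x) ≤ Real.log x := by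
    simpa [g] using hmin
  have h2 := mul_le_mul_of_nonneg_left h1 hx.le
  have h3 : x * ((x - 1) * (5 * x + 1) / (2 * x ^ 2 + 4 * x)) - x + 1
      = 3 * (x - 1) ^ 2 / (2 * x + 4) := by
    field_simp
    ring
  linarith

section Softmax

variable {ι : Type*} [Fintype ι]

/-- Pinsker's inequality for finitely supported, strictly positive distributions. -/
theorem pinsker {p q : ι → ℝ} (hp : ∀ k, 0 < p k) (hq : ∀ k, 0 < q k)
    (hp1 : ∑ k, p k = 1) (hq1 : ∑ k, q k = 1) :
    (∑ k, |p k - q k|) ^ 2 / 2 ≤ ∑ k, p k * (Real.log (p k) - Real.log (q k)) := by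
  -- The scalar inequality at `p k / q k`, scaled by `q k`. Cauchy–Schwarz in `h3` uses the weights
  -- `p k + 2 * q k`, whose sum is `3`, which turns `3 / 2` into `1 / 2`.
  have h1 : ∀ k, 3 / 2 * (|p k - q k| ^ 2 / (p k + 2 * q k)) ≤
      p k * (Real.log (p k) - Real.log (q k)) - p k + q k := by
    intro k
    have hpk := hp k
    have hqk := hq k
    have h := mul_le_mul_of_nonneg_left (div_le_mul_log (div_pos hpk hqk)) hqk.le
    rw [Real.log_div hpk.ne' hqk.ne'] at h
    have e1 : q k * (3 * (p k / q k - 1) ^ 2 / (2 * (p k / q k) + 4)) =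
        3 / 2 * (|p k - q k| ^ 2 / (p k + 2 * q k)) := by
      rw [sq_abs]; field_simp; ring
    have e2 : q k * (p k / q k * (Real.log (p k) - Real.log (q k)) - p k / q k + 1) =
        p k * (Real.log (p k) - Real.log (q k)) - p k + q k := by
      field_simp
    rwa [e1, e2] at h
  have h2 := Finset.sum_le_sum fun k (_ : k ∈ Finset.univ) => h1 k
  have h3 := Finset.sq_sum_div_le_sum_sq_div Finset.univ (fun k => |p k - q k|)
    (g := fun k => p k + 2 * q k) fun k _ => by have := hp k; have := hq k; positivity
  rw [Finset.sum_add_distrib, Finset.sum_sub_distrib, hp1, hq1, ← Finset.mul_sum] at h2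
  rw [Finset.sum_add_distrib, ← Finset.mul_sum, hp1, hq1] at h3
  linarith

theorem logSumExp_zero : logSumExp (0 : ι → ℝ) = Real.log (Fintype.card ι) := by
  simp [logSumExp]

variable [Nonempty ι]

theorem sum_exp_pos (r : ι → ℝ) : 0 < ∑ k, Real.exp (r k) :=
  Finset.sum_pos (fun _ _ => Real.exp_pos _) Finset.univ_nonempty

theorem softmax_pos (r : ι → ℝ) (k : ι) : 0 < softmax r k :=
  div_pos (Real.exp_pos _) (sum_exp_pos r)

theorem sum_softmax (r : ι → ℝ) : ∑ k, softmax r k = 1 := by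
  simp only [softmax, ← Finset.sum_div]
  exact div_self (sum_exp_pos r).ne'

theorem log_softmax (r : ι → ℝ) (k : ι) : Real.log (softmax r k) = r k - logSumExp r := by
  rw [softmax, Real.log_div (Real.exp_pos _).ne' (sum_exp_pos r).ne', Real.log_exp, logSumExp]

theorem le_logSumExp (r : ι → ℝ) (k : ι) : r k ≤ logSumExp r := by
  rw [logSumExp, Real.le_log_iff_exp_le (sum_exp_pos r)]
  exact Finset.single_le_sum (f := fun k => Real.exp (r k)) (fun _ _ => (Real.exp_pos _).le)
    (Finset.mem_univ k)

/-- Since `log (softmax u) = u - logSumExp u`, the right-hand side is the Kullback–Leibler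
divergence of `softmax u` from `softmax v`, so Pinsker's inequality applies. -/
theorem logSumExp_bregman_ge (u v : ι → ℝ) :
    (∑ k, |softmax u k - softmax v k|) ^ 2 / 2 ≤
      logSumExp v - logSumExp u - ∑ k, softmax u k * (v k - u k) := by
  refine (pinsker (softmax_pos u) (softmax_pos v) (sum_softmax u) (sum_softmax v)).trans_eq ?_
  have : ∀ k, softmax u k * (Real.log (softmax u k) - Real.log (softmax v k)) =
      softmax u k * (logSumExp v - logSumExp u) - softmax u k * (v k - u k) := by
    intro k; rw [log_softmax, log_softmax]; ring
  simp only [this]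
  rw [Finset.sum_sub_distrib, ← Finset.sum_mul, sum_softmax, one_mul]

/-- The entropy of a softmax distribution is at most `log |ι|`. -/
theorem logSumExp_le_inner_add_log_card (u : ι → ℝ) :
    logSumExp u ≤ ∑ k, softmax u k * u k + Real.log (Fintype.card ι) := by
  have h := (by positivity : (0:ℝ) ≤ _).trans (logSumExp_bregman_ge u 0)
  rw [logSumExp_zero] at h
  simp only [Pi.zero_apply, zero_sub, mul_neg, Finset.sum_neg_distrib] at h
  linarith

/-- With `z = exp (-s)` this is `s ^ 2 ≤ exp s`, the square of `s ≤ exp (s / 2)`. -/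
theorem mul_log_sq_le_one {z : ℝ} (hz : 0 < z) (hz1 : z ≤ 1) : z * Real.log z ^ 2 ≤ 1 := by
  obtain ⟨s, rfl⟩ : ∃ s, z = Real.exp (-s) := ⟨-Real.log z, by rw [neg_neg, Real.exp_log hz]⟩
  have hs : 0 ≤ s := by
    have := Real.exp_le_one_iff.1 hz1
    linarith
  have h1 : s ≤ Real.exp (s / 2) := by
    have := Real.quadratic_le_exp_of_nonneg (x := s / 2) (by positivity)
    nlinarith [sq_nonneg (s - 2)]
  have h2 : s ^ 2 ≤ Real.exp s := by
    have : Real.exp s = Real.exp (s / 2) ^ 2 := by rw [← Real.exp_nat_mul]; congr 1; push_cast; ring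
    rw [this]
    exact pow_le_pow_left₀ hs h1 2
  rw [Real.log_exp, Real.exp_neg, inv_mul_le_iff₀ (Real.exp_pos s)]
  linarith [neg_sq s]

/-- The variance of the log-probabilities of a distribution on `ι`, here written for a softmax
distribution, is at most `1 + log² |ι|`. -/
theorem softmax_variance_le (r : ι → ℝ) :
    ∑ k, softmax r k * r k ^ 2 - (∑ k, softmax r k * r k) ^ 2 ≤
      1 + Real.log (Fintype.card ι) ^ 2 := by
  set N : ℝ := (Fintype.card ι : ℝ) with hN
  have hN1 : 1 ≤ N := by
    rw [hN]; exact_mod_cast Fintype.card_pos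
  have hN0 : 0 < N := by linarith
  -- With this centre the deviation is `log (N * softmax r k)`. Coordinates below the uniform weight
  -- contribute at most `1 / N` each; the others have logarithm in `[0, log N]`. The second moment
  -- about any point bounds the variance.
  have hterm : ∀ k, softmax r k * (r k - (logSumExp r - Real.log N)) ^ 2 ≤
      1 / N + softmax r k * Real.log N ^ 2 := by
    intro k
    have hx := softmax_pos r k
    have hx1 : softmax r k ≤ 1 := by
      rw [← sum_softmax r]
      exact Finset.single_le_sum (fun k _ => (softmax_pos r k).le) (Finset.mem_univ k)
    have e : r k - (logSumExp r - Real.log N) = Real.log (N * softmax r k) := by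
      rw [Real.log_mul hN0.ne' hx.ne', log_softmax]; ring
    rw [e]
    rcases le_total (N * softmax r k) 1 with h | h
    · have := mul_log_sq_le_one (mul_pos hN0 hx) h
      have h2 : softmax r k * Real.log (N * softmax r k) ^ 2 ≤ 1 / N := by
        rw [le_div_iff₀ hN0]; linarith
      have : 0 ≤ softmax r k * Real.log N ^ 2 := by positivity
      linarith
    · have h1 : 0 ≤ Real.log (N * softmax r k) := Real.log_nonneg h
      have h2 : Real.log (N * softmax r k) ≤ Real.log N :=
        Real.log_le_log (by positivity) (by nlinarith)
      have h3 := mul_le_mul_of_nonneg_left (pow_le_pow_left₀ h1 h2 2) hx.le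
      have : 0 ≤ 1 / N := by positivity
      linarith
  have hsum := Finset.sum_le_sum fun k (_ : k ∈ Finset.univ) => hterm k
  rw [Finset.sum_add_distrib, ← Finset.sum_mul, sum_softmax, Finset.sum_const, Finset.card_univ,
    nsmul_eq_mul, ← hN, mul_one_div_cancel hN0.ne', one_mul] at hsum
  refine le_trans ?_ hsum
  generalize logSumExp r - Real.log N = c
  have : ∀ k, softmax r k * (r k - c) ^ 2 =
      softmax r k * r k ^ 2 - 2 * c * (softmax r k * r k) + c ^ 2 * softmax r k := by
    intro k; ring
  simp only [this]
  rw [Finset.sum_add_distrib, Finset.sum_sub_distrib, ← Finset.mul_sum, ← Finset.mul_sum,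
    sum_softmax]
  nlinarith [sq_nonneg (∑ k, softmax r k * r k - c)]

theorem hasDerivAt_logSumExp_smul (b : ι → ℝ) (l : ℝ) :
    HasDerivAt (fun l : ℝ => logSumExp (l • b)) (∑ k, softmax (l • b) k * b k) l := by
  have h1 : HasDerivAt (fun l : ℝ => ∑ k, Real.exp ((l • b) k))
      (∑ k, Real.exp ((l • b) k) * b k) l := by
    apply HasDerivAt.fun_sum
    intro k _
    have := ((hasDerivAt_id l).mul_const (b k)).exp
    simpa using this
  have h2 := h1.log (sum_exp_pos _).ne'
  refine h2.congr_deriv ?_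
  simp only [softmax, Finset.sum_div]
  exact Finset.sum_congr rfl fun k _ => by ring

theorem hasDerivAt_inner_softmax_smul (b : ι → ℝ) (l : ℝ) :
    HasDerivAt (fun l : ℝ => ∑ k, softmax (l • b) k * b k)
      (∑ k, softmax (l • b) k * b k ^ 2 - (∑ k, softmax (l • b) k * b k) ^ 2) l := by
  have hexp : ∀ k, HasDerivAt (fun l : ℝ => Real.exp ((l • b) k))
      (Real.exp ((l • b) k) * b k) l := by
    intro k
    have := ((hasDerivAt_id l).mul_const (b k)).exp
    simpa using this
  have h1 : HasDerivAt (fun l : ℝ => ∑ k, Real.exp ((l • b) k))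
      (∑ k, Real.exp ((l • b) k) * b k) l := HasDerivAt.fun_sum fun k _ => hexp k
  have h2 : HasDerivAt (fun l : ℝ => ∑ k, Real.exp ((l • b) k) * b k)
      (∑ k, Real.exp ((l • b) k) * b k * b k) l :=
    HasDerivAt.fun_sum fun k _ => (hexp k).mul_const (b k)
  have hS := (sum_exp_pos (l • b)).ne'
  have e : ∀ (l : ℝ) (c : ι → ℝ), ∑ k, softmax (l • b) k * c k =
      (∑ k, Real.exp ((l • b) k) * c k) / ∑ k, Real.exp ((l • b) k) := by
    intro l c
    simp only [softmax, Finset.sum_div]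
    exact Finset.sum_congr rfl fun k _ => by ring
  have h3 := h2.div h1 hS
  simp only [e]
  refine h3.congr_deriv ?_
  have : ∀ k, Real.exp ((l • b) k) * b k ^ 2 = Real.exp ((l • b) k) * b k * b k := by
    intro k; ring
  simp only [this]
  field_simp

/-- After adding `V log l`, the log-sum-exp function is concave along rays. -/
theorem concaveOn_logSumExp_add_log {V : ℝ} (hV : 1 + Real.log (Fintype.card ι) ^ 2 ≤ V)
    (b : ι → ℝ) :
    ConcaveOn ℝ (Set.Ioi 0) fun l : ℝ => logSumExp (l • b) + V * Real.log l := by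
  have hd1 : ∀ l : ℝ, 0 < l → HasDerivAt (fun l : ℝ => logSumExp (l • b) + V * Real.log l)
      (∑ k, softmax (l • b) k * b k + V * l⁻¹) l := fun l hl =>
    (hasDerivAt_logSumExp_smul b l).add ((Real.hasDerivAt_log hl.ne').const_mul V)
  refine concaveOn_of_hasDerivWithinAt2_nonpos (convex_Ioi 0)
    (f' := fun l => ∑ k, softmax (l • b) k * b k + V * l⁻¹)
    (f'' := fun l => (∑ k, softmax (l • b) k * b k ^ 2 - (∑ k, softmax (l • b) k * b k) ^ 2)
      + V * (-(l ^ 2)⁻¹))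
    (fun l hl => (hd1 l hl).continuousAt.continuousWithinAt) ?_ ?_ ?_
  · rw [interior_Ioi]
    exact fun l hl => (hd1 l hl).hasDerivWithinAt
  · rw [interior_Ioi]
    exact fun l hl => ((hasDerivAt_inner_softmax_smul b l).add
      ((hasDerivAt_inv (ne_of_gt hl)).const_mul V)).hasDerivWithinAt
  · rw [interior_Ioi]
    intro l hl
    have hl : 0 < l := hl
    -- The second derivative is `Var b - V / l ^ 2`, and `l ^ 2 * Var b` is the variance of `l • b`.
    have h := (softmax_variance_le (l • b)).trans hV
    have e1 : ∑ k, softmax (l • b) k * (l • b) k ^ 2 = l ^ 2 * ∑ k, softmax (l • b) k * b k ^ 2 := by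
      rw [Finset.mul_sum]
      exact Finset.sum_congr rfl fun k _ => by simp only [Pi.smul_apply, smul_eq_mul]; ring
    have e2 : ∑ k, softmax (l • b) k * (l • b) k = l * ∑ k, softmax (l • b) k * b k := by
      rw [Finset.mul_sum]
      exact Finset.sum_congr rfl fun k _ => by simp only [Pi.smul_apply, smul_eq_mul]; ring
    rw [e1, e2, mul_pow, ← mul_sub, mul_comm, ← le_div_iff₀ (by positivity)] at h
    rw [div_eq_mul_inv] at h
    linarith

/-- A concave function lies below its tangent at `m`. This complements `logSumExp_bregman_ge` by
bounding the divergence along a ray from above. -/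
theorem logSumExp_smul_le {V : ℝ} (hV : 1 + Real.log (Fintype.card ι) ^ 2 ≤ V) (b : ι → ℝ)
    {l m : ℝ} (hl : 0 < l) (hm : 0 < m) :
    logSumExp (l • b) - logSumExp (m • b) - (l - m) * ∑ k, softmax (m • b) k * b k ≤
      V * (l / m - 1 - Real.log (l / m)) := by
  have hc := concaveOn_logSumExp_add_log hV b
  have hd := (hasDerivAt_logSumExp_smul b m).add ((Real.hasDerivAt_log hm.ne').const_mul V)
  rw [Real.log_div hl.ne' hm.ne']
  have key : (logSumExp (l • b) + V * Real.log l) - (logSumExp (m • b) + V * Real.log m) ≤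
      (l - m) * (∑ k, softmax (m • b) k * b k + V * m⁻¹) := by
    rcases lt_trichotomy l m with h | h | h
    · have := hc.le_slope_of_hasDerivAt hl hm h hd
      rw [slope_def_field, le_div_iff₀ (by linarith)] at this
      linarith
    · subst h; simp
    · have := hc.slope_le_of_hasDerivAt hm hl h hd
      rw [slope_def_field, div_le_iff₀ (by linarith)] at this
      linarith
  have e : (l - m) * (V * m⁻¹) = V * (l / m - 1) := by field_simp
  rw [mul_add, e] at key
  linarith

/-- The lower and upper bounds on the divergence combine to control how far a change of rate alone
moves the strategy. -/
theorem sq_dist_softmax_smul_le {V : ℝ} (hV : 1 + Real.log (Fintype.card ι) ^ 2 ≤ V) (b : ι → ℝ)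
    {l m : ℝ} (hl : 0 < l) (hm : 0 < m) :
    (∑ k, |softmax (m • b) k - softmax (l • b) k|) ^ 2 / 2 ≤
      V * (l / m - 1 - Real.log (l / m)) := by
  refine ((logSumExp_bregman_ge (m • b) (l • b)).trans_eq ?_).trans (logSumExp_smul_le hV b hl hm)
  rw [Finset.mul_sum]
  congr 1
  exact Finset.sum_congr rfl fun k _ => by simp only [Pi.smul_apply, smul_eq_mul]; ring

end Softmax

/-! ### The Bregman divergence of the maximal rate objective. -/

namespace DLRC

section Rate

variable {d : ℕ}

theorem rateObjective_eq (α : ℝ) (r : Fin d → ℝ) (l : ℝ) :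
    rateObjective α r l = logSumExp (l • r) + (α - 1) * Real.log l := rfl

/-- The Bregman divergence from `a` to `b` of the maximal rate objective, as a function of the
regret vector; `m` and `m'` are optimal rates for `a` and `b`. -/
noncomputable def rateBregman (α : ℝ) (a b : Fin d → ℝ) (m m' : ℝ) : ℝ :=
  rateObjective α b m' - rateObjective α a m - m * ∑ k, softmax (m • a) k * (b k - a k)

/-- The potential values cancel, leaving the difference of gradients paired with the displacement.
-/
theorem rateBregman_add_swap (α : ℝ) (a b : Fin d → ℝ) (m m' : ℝ) :
    rateBregman α a b m m' + rateBregman α b a m' m =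
      ∑ k, (m' * softmax (m' • b) k - m * softmax (m • a) k) * (b k - a k) := by
  simp only [rateBregman, Finset.mul_sum]
  have : ∀ k, (m' * softmax (m' • b) k - m * softmax (m • a) k) * (b k - a k) =
      -(m * (softmax (m • a) k * (b k - a k))) - m' * (softmax (m' • b) k * (a k - b k)) := by
    intro k; ring
  simp only [this]
  rw [Finset.sum_sub_distrib, Finset.sum_neg_distrib]
  ring

/-- Passing from `(a, m)` to `(b, m')` through `(b, m)` separates the suboptimality of the old rate
at `b` from the log-sum-exp divergence at a fixed rate. -/
theorem rateBregman_eq (α : ℝ) (a b : Fin d → ℝ) (m m' : ℝ) :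
    rateBregman α a b m m' = (rateObjective α b m' - rateObjective α b m) +
      (logSumExp (m • b) - logSumExp (m • a) -
        ∑ k, softmax (m • a) k * ((m • b) k - (m • a) k)) := by
  have : ∑ k, softmax (m • a) k * ((m • b) k - (m • a) k) =
      m * ∑ k, softmax (m • a) k * (b k - a k) := by
    rw [Finset.mul_sum]
    exact Finset.sum_congr rfl fun k _ => by simp only [Pi.smul_apply, smul_eq_mul]; ring
  rw [this, rateBregman, rateObjective_eq α b m, rateObjective_eq α a m]
  ring

theorem sub_one_sub_log_nonneg {q : ℝ} (hq : 0 < q) : 0 ≤ q - 1 - Real.log q := by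
  linarith [Real.log_le_sub_one_of_pos hq]

variable [Nonempty (Fin d)] {η α V : ℝ} {a b : Fin d → ℝ} {m m' : ℝ}

/-- Strong concavity of the rate objective around its maximizer. -/
theorem IsOptimalRate.gap (hV : 1 + Real.log d ^ 2 ≤ V) (h : IsOptimalRate η α b m) {l : ℝ}
    (hl : l ∈ Set.Ioc 0 η) :
    (α - 1 - V) * (l / m - 1 - Real.log (l / m)) ≤ rateObjective α b m - rateObjective α b l := by
  have hm0 : 0 < m := h.1.1
  have hV' : 1 + Real.log (Fintype.card (Fin d)) ^ 2 ≤ V := by simpa using hV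
  have h1 := logSumExp_smul_le hV' b hl.1 hm0
  have hd : HasDerivAt (rateObjective α b) (∑ k, softmax (m • b) k * b k + (α - 1) * m⁻¹) m :=
    (hasDerivAt_logSumExp_smul b m).add ((Real.hasDerivAt_log hm0.ne').const_mul (α - 1))
  -- First-order optimality as a variational inequality, since the maximizer may sit at the endpoint
  -- `η`, where the derivative need not vanish.
  have hfirst : (l - m) * (∑ k, softmax (m • b) k * b k + (α - 1) * m⁻¹) ≤ 0 := by
    have hcone : l - m ∈ posTangentConeAt (Set.Ioc 0 η) m :=
      sub_mem_posTangentConeAt_of_segment_subset ((convex_Ioc 0 η).segment_subset h.1 hl)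
    have := h.2.localize.hasFDerivWithinAt_nonpos hd.hasDerivWithinAt.hasFDerivWithinAt hcone
    simpa using this
  have e : (l - m) * ((α - 1) * m⁻¹) = (α - 1) * (l / m - 1) := by field_simp
  rw [mul_add, e] at hfirst
  rw [rateObjective_eq, rateObjective_eq]
  rw [Real.log_div hl.1.ne' hm0.ne'] at *
  linarith

theorem gap_le_rateBregman (hV : 1 + Real.log d ^ 2 ≤ V) (ha : IsOptimalRate η α a m)
    (hb : IsOptimalRate η α b m') :
    (α - 1 - V) * (m / m' - 1 - Real.log (m / m')) ≤ rateBregman α a b m m' := by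
  rw [rateBregman_eq]
  have h1 := hb.gap hV ha.1
  have h2 := (by positivity : (0:ℝ) ≤ _).trans (logSumExp_bregman_ge (m • a) (m • b))
  linarith

/-- The triangle inequality through `softmax (m • b)` gives distances `X` (regret change) and `Y`
(rate change). The divergence is at least `X ^ 2 / 2 + 8 * Y ^ 2`, and `(X + Y) ^ 2 ≤ 17 / 16 * X ^
2 + 17 * Y ^ 2`. -/
theorem sq_dist_softmax_le_rateBregman (hV : 1 + Real.log d ^ 2 ≤ V) (hA : 16 * V ≤ α - 1 - V)
    (ha : IsOptimalRate η α a m) (hb : IsOptimalRate η α b m') :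
    (∑ k, |softmax (m' • b) k - softmax (m • a) k|) ^ 2 ≤ 17 / 8 * rateBregman α a b m m' := by
  have hV' : 1 + Real.log (Fintype.card (Fin d)) ^ 2 ≤ V := by simpa using hV
  have h1 := hb.gap hV ha.1
  have h2 := logSumExp_bregman_ge (m • a) (m • b)
  have h3 := sq_dist_softmax_smul_le hV' b ha.1.1 hb.1.1
  have hφ := sub_one_sub_log_nonneg (div_pos ha.1.1 hb.1.1)
  have h4 := mul_le_mul_of_nonneg_right hA hφ
  rw [rateBregman_eq]
  set X := ∑ k, |softmax (m • a) k - softmax (m • b) k|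
  set Y := ∑ k, |softmax (m' • b) k - softmax (m • b) k|
  have htri : ∑ k, |softmax (m' • b) k - softmax (m • a) k| ≤ X + Y := by
    rw [← Finset.sum_add_distrib]
    refine Finset.sum_le_sum fun k _ => ?_
    rw [add_comm, abs_sub_comm (softmax (m • a) k)]
    exact abs_sub_le _ _ _
  have h5 := pow_le_pow_left₀ (Finset.sum_nonneg fun k _ => abs_nonneg _) htri 2
  refine h5.trans ?_
  nlinarith [sq_nonneg (X - 16 * Y)]

/-- A self-bounding argument: Hölder's inequality bounds the symmetrized divergence `D` by `w` times
the gradient change, and that change is itself at most `3 / 2 * η * √D`. -/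
theorem rateBregman_add_swap_le (hV : 1 + Real.log d ^ 2 ≤ V) (hA : 16 * V ≤ α - 1 - V)
    (ha : IsOptimalRate η α a m) (hb : IsOptimalRate η α b m') {w : ℝ}
    (hw : ∀ k, |b k - a k| ≤ w) :
    rateBregman α a b m m' + rateBregman α b a m' m ≤ 9 / 4 * η ^ 2 * w ^ 2 := by
  have hm := ha.1.1
  have hm' := hb.1.1
  have hV1 : 1 ≤ V := by nlinarith [sq_nonneg (Real.log d)]
  have hw0 : 0 ≤ w := (abs_nonneg _).trans (hw (Classical.arbitrary _))
  have hη : 0 < η := hm.trans_le ha.1.2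
  have g1 := gap_le_rateBregman hV ha hb
  have g2 := gap_le_rateBregman hV hb ha
  have n1 := sq_dist_softmax_le_rateBregman hV hA ha hb
  have n2 := sq_dist_softmax_le_rateBregman hV hA hb ha
  have hswap := rateBregman_add_swap α a b m m'
  set D := rateBregman α a b m m' + rateBregman α b a m' m with hD
  set N := ∑ k, |softmax (m' • b) k - softmax (m • a) k| with hN
  have hNs : ∑ k, |softmax (m • a) k - softmax (m' • b) k| = N :=
    Finset.sum_congr rfl fun k _ => abs_sub_comm _ _
  rw [hNs] at n2
  have hN0 : 0 ≤ N := Finset.sum_nonneg fun k _ => abs_nonneg _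
  have hN2 : N ^ 2 ≤ 17 / 16 * D := by linarith
  have hD0 : 0 ≤ D := by nlinarith [sq_nonneg N]
  have hrate : (m' - m) ^ 2 ≤ η ^ 2 * D / 16 := by
    have e : (m / m' - 1 - Real.log (m / m')) + (m' / m - 1 - Real.log (m' / m)) =
        (m' - m) ^ 2 / (m * m') := by
      rw [Real.log_div hm.ne' hm'.ne', Real.log_div hm'.ne' hm.ne']
      field_simp
      ring
    have h1 : (α - 1 - V) * ((m' - m) ^ 2 / (m * m')) ≤ D := by
      rw [← e]; linarith
    have h2 : 16 * ((m' - m) ^ 2 / (m * m')) ≤ D :=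
      (mul_le_mul_of_nonneg_right (by linarith) (by positivity)).trans h1
    have h3 : (m' - m) ^ 2 ≤ D / 16 * (m * m') := by
      rw [← div_le_iff₀ (by positivity)]; linarith
    have h4 : m * m' ≤ η ^ 2 := by
      rw [sq]; exact mul_le_mul ha.1.2 hb.1.2 hm'.le hη.le
    nlinarith [mul_le_mul_of_nonneg_left h4 (by positivity : 0 ≤ D / 16)]
  have hlin : D ≤ w * (η * N + |m' - m|) := by
    rw [hswap]
    have hterm : ∀ k, (m' * softmax (m' • b) k - m * softmax (m • a) k) * (b k - a k) ≤
        w * (η * |softmax (m' • b) k - softmax (m • a) k| + |m' - m| * softmax (m' • b) k) := by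
      intro k
      refine (le_abs_self _).trans ?_
      rw [abs_mul, mul_comm w]
      refine mul_le_mul ?_ (hw k) (abs_nonneg _) ?_
      · have e : m' * softmax (m' • b) k - m * softmax (m • a) k =
            m * (softmax (m' • b) k - softmax (m • a) k) + (m' - m) * softmax (m' • b) k := by ring
        rw [e]
        refine (abs_add_le _ _).trans ?_
        rw [abs_mul, abs_mul, abs_of_pos hm, abs_of_pos (softmax_pos _ k)]
        gcongr
        exact ha.1.2
      · have := softmax_pos (m' • b) k
        positivity
    refine (Finset.sum_le_sum fun k _ => hterm k).trans_eq ?_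
    rw [← Finset.mul_sum, Finset.sum_add_distrib, ← Finset.mul_sum, ← Finset.mul_sum, sum_softmax,
      mul_one]
  -- The constant is `2 * (17 / 16) + 2 * (1 / 16) = 9 / 4`, from `hN2` and `hrate`.
  have hsq : (η * N + |m' - m|) ^ 2 ≤ 9 / 4 * η ^ 2 * D := by
    have h1 : (η * N + |m' - m|) ^ 2 ≤ 2 * (η * N) ^ 2 + 2 * (m' - m) ^ 2 := by
      rw [← sq_abs (m' - m)]
      nlinarith [sq_nonneg (η * N - |m' - m|)]
    have h2 := mul_le_mul_of_nonneg_left hN2 (sq_nonneg η)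
    rw [mul_pow] at h1
    linarith
  have hDD : D ^ 2 ≤ w ^ 2 * (9 / 4 * η ^ 2 * D) := by
    refine (pow_le_pow_left₀ hD0 hlin 2).trans ?_
    rw [mul_pow]
    exact mul_le_mul_of_nonneg_left hsq (sq_nonneg w)
  rcases hD0.eq_or_lt with h | h
  · rw [← h]; positivity
  · refine le_of_mul_le_mul_right ?_ h
    linarith

end Rate

/-! ### Optimality of the rate played and the single-learner potential bound. -/

section LearningRate

variable {d : ℕ} {η α β : ℝ}

/-- When the regret vector is not too negative, the cap is optimal. -/
theorem isOptimalRate_cap (hd : 1 ≤ d) (hη : 0 < η) (hη1 : η ≤ 1) (hβ : 1 ≤ β)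
    (hα : 2 + Real.log d + β * Real.log d ^ 2 ≤ α) {r : Fin d → ℝ}
    (hr : ∃ k, r k ≥ -β * Real.log d ^ 2) : IsOptimalRate η α r η := by
  have : Nonempty (Fin d) := ⟨⟨0, hd⟩⟩
  refine ⟨⟨hη, le_rfl⟩, fun l hl => ?_⟩
  simp only [Set.mem_ofPred_eq]
  obtain ⟨k, hk⟩ := hr
  have hlog : 0 ≤ Real.log d := Real.log_nonneg (by exact_mod_cast hd)
  have hsq := sq_nonneg (Real.log d)
  have h1 := logSumExp_smul_le (V := 1 + Real.log d ^ 2) (by simp) r hl.1 hη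
  have h2 := logSumExp_le_inner_add_log_card (η • r)
  have h3 := le_logSumExp (η • r) k
  have e : ∑ k, softmax (η • r) k * (η • r) k = η * ∑ k, softmax (η • r) k * r k := by
    rw [Finset.mul_sum]
    exact Finset.sum_congr rfl fun k _ => by simp only [Pi.smul_apply, smul_eq_mul]; ring
  rw [e] at h2
  simp only [Pi.smul_apply, smul_eq_mul, Fintype.card_fin] at h2 h3
  set g := ∑ k, softmax (η • r) k * r k
  have h4 : -(β * Real.log d ^ 2) ≤ η * r k := by
    have h5 : η * (-(β * Real.log d ^ 2)) ≤ η * r k :=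
      mul_le_mul_of_nonneg_left (by linarith) hη.le
    have h6 : 0 ≤ β * Real.log d ^ 2 := by positivity
    nlinarith
  have hq : l / η ≤ 1 := (div_le_one hη).2 hl.2
  have hlogq := Real.log_le_sub_one_of_pos (div_pos hl.1 hη)
  have hβsq : Real.log d ^ 2 ≤ β * Real.log d ^ 2 := by nlinarith
  have e2 : (l - η) * g = (l / η - 1) * (η * g) := by field_simp
  rw [e2] at h1
  rw [rateObjective_eq, rateObjective_eq]
  have e3 : Real.log l = Real.log η + Real.log (l / η) := by
    rw [Real.log_div hl.1.ne' hη.ne']; ring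
  rw [e3]
  have h7 := mul_le_mul_of_nonneg_left hlogq
    (by linarith : 0 ≤ α - 1 - (1 + Real.log d ^ 2))
  -- The factor `η * g + (α - 1)` is `η` times the derivative of the objective at `η`. It is
  -- nonnegative because the entropy bound gives `η * g ≥ η * r k - log d`, and `α` is large enough
  -- to offset the threshold `-β log² d`.
  have h8 : (l / η - 1) * (η * g + (α - 1)) ≤ 0 :=
    mul_nonpos_of_nonpos_of_nonneg (by linarith) (by linarith)
  linarith

/-- The learning rate is always a maximizer of the learning rate control objective. -/
theorem isOptimalRate_learningRate (hd : 1 ≤ d) (hη : 0 < η) (hη1 : η ≤ 1) (hβ : 1 ≤ β)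
    (hα : 2 + Real.log d + β * Real.log d ^ 2 ≤ α) (r : Fin d → ℝ) :
    IsOptimalRate η α r (learningRate η α β r) := by
  rw [learningRate]
  split_ifs with h
  · exact isOptimalRate_cap hd hη hη1 hβ hα h
  · have hlog : 0 ≤ Real.log d := Real.log_nonneg (by exact_mod_cast hd)
    have : 0 ≤ β * Real.log d ^ 2 := by positivity
    exact Classical.epsilon_spec (exists_isOptimalRate hd hη (by linarith) r)

theorem learningRate_zero (hβ : 0 ≤ β) (hd : 1 ≤ d) : learningRate η α β (0 : Fin d → ℝ) = η := by
  rw [learningRate, if_pos]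
  refine ⟨⟨0, hd⟩, ?_⟩
  have : 0 ≤ β * Real.log d ^ 2 := by positivity
  simp only [Pi.zero_apply]
  linarith

/-- The maximal value of the learning rate control objective. -/
noncomputable def potential (η α β : ℝ) (r : Fin d → ℝ) : ℝ :=
  rateObjective α r (learningRate η α β r)

theorem potential_zero (hβ : 0 ≤ β) (hd : 1 ≤ d) :
    potential η α β (0 : Fin d → ℝ) = Real.log d + (α - 1) * Real.log η := by
  rw [potential, learningRate_zero hβ hd, rateObjective_eq, smul_zero, logSumExp_zero,
    Fintype.card_fin]

/-- The mixed strategy as a function of the optimistic regret vector. -/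
noncomputable def respond (η α β : ℝ) (r : Fin d → ℝ) : Fin d → ℝ :=
  softmax (learningRate η α β r • r)

/-- The regret bound of a single learner facing corrected utilities `u`, in terms of the variation
`w` of the utilities and the movement of its strategies. -/
theorem potential_le (hd : 1 ≤ d) (hη : 0 < η) (hη1 : η ≤ 1) (hβ : 1 ≤ β)
    (hα : 2 + Real.log d + β * Real.log d ^ 2 ≤ α) (hα' : 18 + 17 * Real.log d ^ 2 ≤ α)
    {U v : ℕ → Fin d → ℝ} {w : ℕ → ℝ} (hU0 : U 0 = 0) (hv0 : v 0 = 0)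
    (hU : ∀ t, U (t + 1) = U t + v (t + 1))
    (horth : ∀ t, ∑ k, respond η α β (U t + v t) k * v (t + 1) k = 0)
    (hw : ∀ t k, |v (t + 1) k - v t k| ≤ w t) (T : ℕ) :
    potential η α β (U (T + 1)) ≤ potential η α β (0 : Fin d → ℝ) +
      27 / 8 * η ^ 2 * ∑ t ∈ Finset.range (T + 1), w t ^ 2 -
      4 / 17 * ∑ t ∈ Finset.range T,
        (∑ k, |respond η α β (U (t + 1) + v (t + 1)) k - respond η α β (U t + v t) k|) ^ 2 := by
  have : Nonempty (Fin d) := ⟨⟨0, hd⟩⟩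
  have hopt := isOptimalRate_learningRate hd hη hη1 hβ hα
  have hA : 16 * (1 + Real.log d ^ 2) ≤ α - 1 - (1 + Real.log d ^ 2) := by linarith
  let D : (Fin d → ℝ) → (Fin d → ℝ) → ℝ := fun a b =>
    rateBregman α a b (learningRate η α β a) (learningRate η α β b)
  have hsymm : ∀ t, D (U t + v t) (U (t + 1)) + D (U (t + 1)) (U t + v t) ≤
      9 / 4 * η ^ 2 * w t ^ 2 := by
    intro t
    refine rateBregman_add_swap_le le_rfl hA (hopt _) (hopt _) fun k => ?_
    rw [hU]
    simpa using hw t k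
  have hdist : ∀ a b, (∑ k, |respond η α β b k - respond η α β a k|) ^ 2 ≤ 17 / 8 * D a b :=
    fun a b => sq_dist_softmax_le_rateBregman le_rfl hA (hopt a) (hopt b)
  have hD0 : ∀ a b, 0 ≤ D a b := fun a b => by
    have := (sq_nonneg _).trans (hdist a b)
    linarith
  -- Both divergences start at the optimistic vector `U t + v t`. Their linear terms differ by a
  -- multiple of the pairing of the strategy with `v (t + 1)`, which is zero.
  have hstep : ∀ t, potential η α β (U (t + 1)) - potential η α β (U t) =
      D (U t + v t) (U (t + 1)) - D (U t + v t) (U t) := by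
    intro t
    simp only [D, rateBregman, potential]
    have e : ∑ k, softmax (learningRate η α β (U t + v t) • (U t + v t)) k *
          (U (t + 1) k - (U t + v t) k) -
        ∑ k, softmax (learningRate η α β (U t + v t) • (U t + v t)) k *
          (U t k - (U t + v t) k) = 0 := by
      rw [← Finset.sum_sub_distrib, ← horth t]
      refine Finset.sum_congr rfl fun k _ => ?_
      rw [hU, respond]
      simp only [Pi.add_apply]
      ring
    linear_combination (learningRate η α β (U t + v t)) * e
  have hpos : ∀ t, D (U t + v t) (U (t + 1)) ≤ 9 / 4 * η ^ 2 * w t ^ 2 := fun t => by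
    linarith [hsymm t, hD0 (U (t + 1)) (U t + v t)]
  -- The movement between consecutive optimistic vectors passes through `U (t + 1)`. One leg is paid
  -- by the negative divergence of the next round, the other by `hsymm` at cost `9 / 8`.
  have hneg : ∀ t, 4 / 17 *
        (∑ k, |respond η α β (U (t + 1) + v (t + 1)) k - respond η α β (U t + v t) k|) ^ 2 -
      9 / 8 * η ^ 2 * w t ^ 2 ≤ D (U (t + 1) + v (t + 1)) (U (t + 1)) := by
    intro t
    have h1 := hdist (U t + v t) (U (t + 1))
    have h2 := hdist (U (t + 1)) (U t + v t)
    have h3 := hdist (U (t + 1) + v (t + 1)) (U (t + 1))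
    have h4 := hsymm t
    simp only [abs_sub_comm (respond η α β (U t + v t) _)] at h2
    set X := ∑ k, |respond η α β (U (t + 1)) k - respond η α β (U t + v t) k|
    set Y := ∑ k, |respond η α β (U (t + 1)) k - respond η α β (U (t + 1) + v (t + 1)) k|
    have htri : ∑ k, |respond η α β (U (t + 1) + v (t + 1)) k - respond η α β (U t + v t) k| ≤
        Y + X := by
      rw [← Finset.sum_add_distrib]
      refine Finset.sum_le_sum fun k _ => ?_
      rw [abs_sub_comm (respond η α β (U (t + 1)) k) (respond η α β (U (t + 1) + v (t + 1)) k)]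
      exact abs_sub_le _ _ _
    have h5 := pow_le_pow_left₀ (Finset.sum_nonneg fun k _ => abs_nonneg _) htri 2
    nlinarith [sq_nonneg (X - Y)]
  -- The last variation carries only `9 / 4`: its remaining `9 / 8` is charged when the next round's
  -- negative divergence is used, giving `27 / 8` in total.
  have hmain : potential η α β (U (T + 1)) ≤ potential η α β (0 : Fin d → ℝ) +
      (27 / 8 * η ^ 2 * ∑ t ∈ Finset.range T, w t ^ 2 + 9 / 4 * η ^ 2 * w T ^ 2) -
      4 / 17 * ∑ t ∈ Finset.range T,
        (∑ k, |respond η α β (U (t + 1) + v (t + 1)) k - respond η α β (U t + v t) k|) ^ 2 := by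
    induction T with
    | zero =>
      have h0 : D (U 0 + v 0) (U 0) = 0 := by
        simp [D, rateBregman, hU0, hv0]
      have h1 := hstep 0
      have h2 := hpos 0
      rw [h0, hU0] at h1
      rw [hU0] at h2
      simp only [Finset.sum_range_zero]
      linarith
    | succ T ih =>
      rw [Finset.sum_range_succ _ T, Finset.sum_range_succ _ T]
      have h1 := hstep (T + 1)
      have h2 := hpos (T + 1)
      have h3 := hneg T
      linarith
  have h3 : 0 ≤ η ^ 2 * w T ^ 2 := by positivity
  rw [Finset.sum_range_succ _ T]
  linarith

end LearningRate

end DLRC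

/-! ### Multilinear utilities, smoothness and deviations. -/

namespace NormalFormGame

variable {n d : ℕ} (G : NormalFormGame n d)

theorem prod_update_apply (x : Fin n → Fin d → ℝ) (j : Fin n) (p : Fin d → ℝ)
    (s : Fin n → Fin d) :
    ∏ l, Function.update x j p l (s l) = p (s j) * ∏ l ∈ Finset.univ.erase j, x l (s l) := by
  rw [← Finset.mul_prod_erase _ _ (Finset.mem_univ j), Function.update_self]
  congr 1
  refine Finset.prod_congr rfl fun l hl => ?_
  rw [Function.update_of_ne (Finset.ne_of_mem_erase hl)]

/-- The expected utility is linear in each player's mixed strategy. -/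
theorem expectedUtility_update (i j : Fin n) (x : Fin n → Fin d → ℝ) (p : Fin d → ℝ) :
    G.expectedUtility i (Function.update x j p) =
      ∑ k, p k * G.expectedUtility i (Function.update x j (Pi.single k 1)) := by
  simp only [expectedUtility, prod_update_apply, Finset.mul_sum]
  rw [Finset.sum_comm]
  refine Finset.sum_congr rfl fun s _ => ?_
  rw [Finset.sum_eq_single (s j)]
  · simp; ring
  · intro k _ hk
    simp [Pi.single_eq_of_ne hk.symm]
  · simp

theorem sum_mul_utilityGradient (i : Fin n) (x : Fin n → Fin d → ℝ) :
    ∑ k, G.utilityGradient i x k * x i k = G.expectedUtility i x := by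
  conv_rhs => rw [← Function.update_eq_self i x, expectedUtility_update]
  exact Finset.sum_congr rfl fun k _ => mul_comm _ _

theorem sum_prod_eq_one {x : Fin n → Fin d → ℝ} (hx : ∀ j, x j ∈ stdSimplex ℝ (Fin d)) :
    ∑ s : Fin n → Fin d, ∏ j, x j (s j) = 1 := by
  rw [← Fintype.piFinset_univ, ← Finset.prod_univ_sum]
  exact Finset.prod_eq_one fun j _ => (hx j).2

theorem prod_nonneg_of_mem {x : Fin n → Fin d → ℝ} (hx : ∀ j, x j ∈ stdSimplex ℝ (Fin d))
    (s : Fin n → Fin d) : 0 ≤ ∏ j, x j (s j) :=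
  Finset.prod_nonneg fun j _ => (hx j).1 _

variable {G}

theorem IsBounded.abs_expectedUtility_le (hG : G.IsBounded) (i : Fin n)
    {x : Fin n → Fin d → ℝ} (hx : ∀ j, x j ∈ stdSimplex ℝ (Fin d)) :
    |G.expectedUtility i x| ≤ 1 := by
  rw [← sum_prod_eq_one hx]
  refine (Finset.abs_sum_le_sum_abs _ _).trans (Finset.sum_le_sum fun s _ => ?_)
  rw [abs_mul, abs_of_nonneg (prod_nonneg_of_mem hx s)]
  exact mul_le_of_le_one_right (prod_nonneg_of_mem hx s) (hG i s)

theorem update_mem_stdSimplex {x : Fin n → Fin d → ℝ} (hx : ∀ j, x j ∈ stdSimplex ℝ (Fin d))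
    (i : Fin n) {p : Fin d → ℝ} (hp : p ∈ stdSimplex ℝ (Fin d)) (j : Fin n) :
    Function.update x i p j ∈ stdSimplex ℝ (Fin d) := by
  rcases eq_or_ne j i with rfl | h
  · rwa [Function.update_self]
  · rw [Function.update_of_ne h]; exact hx j

theorem IsBounded.abs_utilityGradient_le (hG : G.IsBounded) (i : Fin n)
    {x : Fin n → Fin d → ℝ} (hx : ∀ j, x j ∈ stdSimplex ℝ (Fin d)) (a : Fin d) :
    |G.utilityGradient i x a| ≤ 1 :=
  hG.abs_expectedUtility_le i (update_mem_stdSimplex hx i (single_mem_stdSimplex ℝ a))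

/-- A hybrid argument: strategies are replaced one player at a time, and each replacement is linear
with coefficients in `[-1, 1]`. -/
theorem IsBounded.abs_expectedUtility_sub_le (hG : G.IsBounded) (i : Fin n)
    {x x' : Fin n → Fin d → ℝ} (hx : ∀ j, x j ∈ stdSimplex ℝ (Fin d))
    (hx' : ∀ j, x' j ∈ stdSimplex ℝ (Fin d)) :
    |G.expectedUtility i x - G.expectedUtility i x'| ≤ ∑ j, ∑ k, |x j k - x' j k| := by
  have key : ∀ J : Finset (Fin n),
      |G.expectedUtility i x - G.expectedUtility i (J.piecewise x' x)| ≤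
        ∑ j ∈ J, ∑ k, |x j k - x' j k| := by
    intro J
    induction J using Finset.induction_on with
    | empty => simp
    | insert j J hj ih =>
      set z := J.piecewise x' x with hz
      have hzmem : ∀ l, z l ∈ stdSimplex ℝ (Fin d) := by
        intro l
        by_cases hl : l ∈ J
        · simp only [hz, Finset.piecewise_eq_of_mem _ _ _ hl]; exact hx' l
        · simp only [hz, Finset.piecewise_eq_of_notMem _ _ _ hl]; exact hx l
      have hzj : z j = x j := Finset.piecewise_eq_of_notMem _ _ _ hj
      have hstep : |G.expectedUtility i z - G.expectedUtility i (Function.update z j (x' j))| ≤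
          ∑ k, |x j k - x' j k| := by
        conv_lhs => rw [← Function.update_eq_self j z, Function.update_idem, hzj]
        rw [expectedUtility_update, expectedUtility_update, ← Finset.sum_sub_distrib]
        refine (Finset.abs_sum_le_sum_abs _ _).trans (Finset.sum_le_sum fun k _ => ?_)
        rw [← sub_mul, abs_mul]
        exact mul_le_of_le_one_right (abs_nonneg _)
          (hG.abs_expectedUtility_le i (update_mem_stdSimplex hzmem j (single_mem_stdSimplex ℝ k)))
      rw [Finset.piecewise_insert, Finset.sum_insert hj, add_comm]
      exact (abs_sub_le _ _ _).trans (add_le_add ih hstep)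
  simpa using key Finset.univ

/-- Every game with utilities in `[-1, 1]` is `1`-smooth. -/
theorem IsBounded.isSmooth_one (hG : G.IsBounded) : G.IsSmooth 1 := by
  intro i x x' hx hx'
  rw [one_mul, pi_norm_le_iff_of_nonneg (by positivity)]
  intro a
  have ha := single_mem_stdSimplex ℝ a
  refine (hG.abs_expectedUtility_sub_le i (update_mem_stdSimplex hx i ha)
    (update_mem_stdSimplex hx' i ha)).trans (Finset.sum_le_sum fun j _ => ?_)
  rcases eq_or_ne j i with rfl | h
  · simp only [Function.update_self, sub_self, abs_zero, Finset.sum_const_zero]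
    positivity
  · simp only [Function.update_of_ne h]; exact le_rfl

variable (G)

/-- Deviating to the fixed strategy `a` under a product distribution. -/
theorem sum_prod_mul_utility_update (i : Fin n) {x : Fin n → Fin d → ℝ}
    (hx : ∑ k, x i k = 1) (a : Fin d) :
    ∑ s, (∏ j, x j (s j)) * G.utility i (Function.update s i a) = G.utilityGradient i x a := by
  have hQ : ∀ (s : Fin n → Fin d) (k : Fin d),
      ∏ l ∈ Finset.univ.erase i, x l (Function.update s i k l) =
        ∏ l ∈ Finset.univ.erase i, x l (s l) := fun s k =>
    Finset.prod_congr rfl fun l hl => by rw [Function.update_of_ne (Finset.ne_of_mem_erase hl)]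
  have hl : ∀ s : Fin n → Fin d, ∏ j, x j (s j) = x i (s i) *
      ∏ l ∈ Finset.univ.erase i, x l (s l) := fun s =>
    (Finset.mul_prod_erase _ _ (Finset.mem_univ i)).symm
  let f : (Fin n → Fin d) × Fin d → ℝ := fun p =>
    x i (p.1 i) * (Pi.single a (1 : ℝ) : Fin d → ℝ) p.2 *
      (∏ l ∈ Finset.univ.erase i, x l (p.1 l)) * G.utility i (Function.update p.1 i p.2)
  -- The involution exchanging player `i`'s sampled action with the deviation. Afterwards the
  -- discarded sample is summed out with total mass `1`.
  let e : (Fin n → Fin d) × Fin d ≃ (Fin n → Fin d) × Fin d :=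
    { toFun := fun p => (Function.update p.1 i p.2, p.1 i)
      invFun := fun p => (Function.update p.1 i p.2, p.1 i)
      left_inv := fun p => by simp
      right_inv := fun p => by simp }
  have h1 : ∑ s, (∏ j, x j (s j)) * G.utility i (Function.update s i a) = ∑ p, f p := by
    rw [Fintype.sum_prod_type]
    refine Finset.sum_congr rfl fun s _ => ?_
    rw [Finset.sum_eq_single a]
    · simp [f, hl]
    · intro k _ hk
      simp [f, Pi.single_eq_of_ne hk]
    · simp
  have h2 : G.utilityGradient i x a = ∑ p, f (e p) := by
    rw [Fintype.sum_prod_type, utilityGradient, expectedUtility]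
    refine Finset.sum_congr rfl fun s _ => ?_
    simp only [f, e, Equiv.coe_fn_mk, Function.update_self, Function.update_idem,
      Function.update_eq_self, hQ, prod_update_apply]
    simp only [mul_assoc]
    rw [← Finset.sum_mul, hx, one_mul]
  rw [h1, h2, Equiv.sum_comp e f]

end NormalFormGame

/-! ### From regret to coarse correlated equilibrium. -/

namespace DLRC

variable {n d : ℕ} (G : NormalFormGame n d) (η α β : ℝ)

theorem play_mem_stdSimplex (hd : 1 ≤ d) (t : ℕ) (j : Fin n) :
    play G η α β t j ∈ stdSimplex ℝ (Fin d) := by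
  have : Nonempty (Fin d) := ⟨⟨0, hd⟩⟩
  change softmax _ ∈ _
  exact ⟨fun k => (softmax_pos _ k).le, sum_softmax _⟩

theorem last_succ (t : ℕ) (i : Fin n) (a : Fin d) :
    (selfPlay G η α β (t + 1) i).last a = G.utilityGradient i (play G η α β t) a -
      ∑ k, G.utilityGradient i (play G η α β t) k * play G η α β t i k := rfl

theorem cumulative_succ (t : ℕ) (i : Fin n) :
    (selfPlay G η α β (t + 1) i).cumulative =
      (selfPlay G η α β t i).cumulative + (selfPlay G η α β (t + 1) i).last := rfl

theorem cumulative_eq_sum (T : ℕ) (i : Fin n) (a : Fin d) :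
    (selfPlay G η α β T i).cumulative a =
      ∑ t ∈ Finset.range T, (selfPlay G η α β (t + 1) i).last a := by
  induction T with
  | zero => rfl
  | succ T ih => rw [Finset.sum_range_succ, ← ih, cumulative_succ]; rfl

/-- Regret bounds for all players turn the empirical distribution of play into an approximate
coarse correlated equilibrium. -/
theorem isApproxCCE_empiricalPlay (hd : 1 ≤ d) {T : ℕ} (hT : 1 ≤ T) {ε : ℝ}
    (h : ∀ i a, (selfPlay G η α β T i).cumulative a ≤ T * ε) :
    G.IsApproxCCE ε (empiricalPlay G η α β T) := by
  have hT0 : (0 : ℝ) < T := by exact_mod_cast hT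
  have hx := fun t j => play_mem_stdSimplex G η α β hd t j
  have hmix : ∀ g : (Fin n → Fin d) → ℝ, ∑ s, empiricalPlay G η α β T s * g s =
      1 / (T : ℝ) * ∑ t ∈ Finset.range T, ∑ s, (∏ j, play G η α β t j (s j)) * g s := by
    intro g
    rw [Finset.sum_comm, Finset.mul_sum]
    refine Finset.sum_congr rfl fun s _ => ?_
    rw [empiricalPlay, mul_assoc, Finset.sum_mul]
  refine ⟨⟨fun s => ?_, ?_⟩, fun i a => ?_⟩
  · exact mul_nonneg (by positivity) (Finset.sum_nonneg fun t _ =>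
      NormalFormGame.prod_nonneg_of_mem (hx t) s)
  · have := hmix fun _ => 1
    simp only [mul_one, NormalFormGame.sum_prod_eq_one (hx _), Finset.sum_const,
      Finset.card_range, nsmul_eq_mul] at this
    rw [this]
    field_simp
  · rw [hmix, hmix]
    -- The coordinate `a` of the cumulative corrected utility is exactly the regret against the
    -- fixed strategy `a`.
    have hreg := h i a
    rw [cumulative_eq_sum] at hreg
    simp only [last_succ, NormalFormGame.sum_mul_utilityGradient] at hreg
    simp only [G.sum_prod_mul_utility_update i (hx _ i).2 a]
    rw [Finset.sum_sub_distrib] at hreg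
    have h2 := mul_le_mul_of_nonneg_left hreg (by positivity : 0 ≤ 1 / (T : ℝ))
    have h3 : 1 / (T : ℝ) * (T * ε) = ε := by field_simp
    rw [h3, mul_sub] at h2
    change _ ≤ 1 / (T : ℝ) * ∑ t ∈ Finset.range T, G.expectedUtility i (play G η α β t)
    linarith

end DLRC

/-! ### Movement and regret in self-play. -/

namespace DLRC

section SelfPlay

variable {n d : ℕ} (G : NormalFormGame n d) (η α β : ℝ)

/-- The `ℓ₁` distance between the strategies of player `j` in two consecutive rounds. -/
noncomputable def movement (t : ℕ) (j : Fin n) : ℝ :=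
  ∑ k, |play G η α β (t + 1) j k - play G η α β t j k|

theorem sum_play_mul_last (hd : 1 ≤ d) (t : ℕ) (i : Fin n) :
    ∑ k, play G η α β t i k * (selfPlay G η α β (t + 1) i).last k = 0 := by
  simp only [last_succ, mul_sub, Finset.sum_sub_distrib, ← Finset.sum_mul]
  rw [(play_mem_stdSimplex G η α β hd t i).2, one_mul, sub_eq_zero]
  exact Finset.sum_congr rfl fun k _ => mul_comm _ _

variable {G}

theorem abs_last_le (hG : G.IsBounded) (hd : 1 ≤ d) (t : ℕ) (i : Fin n) (a : Fin d) :
    |(selfPlay G η α β (t + 1) i).last a| ≤ 2 := by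
  have hx := play_mem_stdSimplex G η α β hd t
  rw [last_succ, G.sum_mul_utilityGradient]
  have h1 := hG.abs_utilityGradient_le i hx a
  have h2 := hG.abs_expectedUtility_le i hx
  exact (abs_sub _ _).trans (by linarith)

/-- This crude bound is enough to keep the potential from becoming too negative, and stands in for
nonnegativity of regret. -/
theorem neg_two_mul_le_cumulative (hG : G.IsBounded) (hd : 1 ≤ d) (T : ℕ) (i : Fin n)
    (a : Fin d) : -(2 * T : ℝ) ≤ (selfPlay G η α β T i).cumulative a := by
  rw [cumulative_eq_sum]
  have h := Finset.sum_le_sum fun t (_ : t ∈ Finset.range T) =>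
    (abs_le.1 (abs_last_le η α β hG hd t i a)).1
  rw [Finset.sum_const, Finset.card_range, nsmul_eq_mul] at h
  linarith

/-- The gradient change enters twice, in the coordinate and in the subtracted average; the player's
own movement changes the averaging weights. -/
theorem abs_last_sub_le (hG : G.IsBounded) {L : ℝ} (hL : G.IsSmooth L) (hd : 1 ≤ d) (t : ℕ)
    (i : Fin n) (a : Fin d) :
    |(selfPlay G η α β (t + 1 + 1) i).last a - (selfPlay G η α β (t + 1) i).last a| ≤
      2 * L * ∑ j, movement G η α β t j + movement G η α β t i := by
  have hx := play_mem_stdSimplex G η α β hd t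
  have hx' := play_mem_stdSimplex G η α β hd (t + 1)
  have hs := hL i _ _ hx' hx
  change _ ≤ L * ∑ j, movement G η α β t j at hs
  set g := G.utilityGradient i (play G η α β t) with hg
  set g' := G.utilityGradient i (play G η α β (t + 1)) with hg'
  have hcoord : ∀ k, |g' k - g k| ≤ L * ∑ j, movement G η α β t j := fun k =>
    (norm_le_pi_norm (g' - g) k).trans hs
  have e : (selfPlay G η α β (t + 1 + 1) i).last a - (selfPlay G η α β (t + 1) i).last a =
      (g' a - g a) - ∑ k, (g' k - g k) * play G η α β (t + 1) i k -
        ∑ k, g k * (play G η α β (t + 1) i k - play G η α β t i k) := by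
    rw [last_succ, last_succ, ← hg, ← hg']
    simp only [sub_mul, mul_sub, Finset.sum_sub_distrib]
    ring
  have h1 : |∑ k, (g' k - g k) * play G η α β (t + 1) i k| ≤ L * ∑ j, movement G η α β t j := by
    refine (Finset.abs_sum_le_sum_abs _ _).trans ?_
    rw [← mul_one (L * _), ← (hx' i).2, Finset.mul_sum]
    refine Finset.sum_le_sum fun k _ => ?_
    rw [abs_mul, abs_of_nonneg ((hx' i).1 k)]
    exact mul_le_mul_of_nonneg_right (hcoord k) ((hx' i).1 k)
  have h2 : |∑ k, g k * (play G η α β (t + 1) i k - play G η α β t i k)| ≤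
      movement G η α β t i := by
    refine (Finset.abs_sum_le_sum_abs _ _).trans (Finset.sum_le_sum fun k _ => ?_)
    rw [abs_mul]
    exact mul_le_of_le_one_left (abs_nonneg _) (hG.abs_utilityGradient_le i hx k)
  rw [e]
  have h3 := abs_sub (g' a - g a - ∑ k, (g' k - g k) * play G η α β (t + 1) i k)
    (∑ k, g k * (play G η α β (t + 1) i k - play G η α β t i k))
  have h4 := abs_sub (g' a - g a) (∑ k, (g' k - g k) * play G η α β (t + 1) i k)
  linarith [hcoord a]

variable {η α β}

/-- Any admissible rate is a competitor in the maximum. The choice `l = η` reads off regret, while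
`l = η / (T + 1)` bounds the potential from below. -/
theorem le_potential (hd : 1 ≤ d) (hη : 0 < η) (hη1 : η ≤ 1) (hβ : 1 ≤ β)
    (hα : 2 + Real.log d + β * Real.log d ^ 2 ≤ α) (r : Fin d → ℝ) (a : Fin d) {l : ℝ}
    (hl : l ∈ Set.Ioc 0 η) : l * r a + (α - 1) * Real.log l ≤ potential η α β r := by
  have : Nonempty (Fin d) := ⟨a⟩
  have h := (isOptimalRate_learningRate hd hη hη1 hβ hα r).2 hl
  simp only [Set.mem_ofPred_eq] at h
  refine le_trans ?_ h
  rw [rateObjective_eq]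
  gcongr
  exact le_logSumExp (l • r) a

/-- The regret bound of one player in self-play, in terms of the movement of all strategies. -/
theorem potential_selfPlay_le (hG : G.IsBounded) {L : ℝ} (hL : G.IsSmooth L)
    (hd : 1 ≤ d) (hη : 0 < η) (hη1 : η ≤ 1 / 50) (hβ : 1 ≤ β)
    (hα : 2 + Real.log d + β * Real.log d ^ 2 ≤ α) (hα' : 18 + 17 * Real.log d ^ 2 ≤ α)
    (T : ℕ) (i : Fin n) :
    potential η α β (selfPlay G η α β (T + 1) i).cumulative ≤
      Real.log d + (α - 1) * Real.log η + 1 / 100 +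
      27 * η ^ 2 * L ^ 2 * n * ∑ j, ∑ t ∈ Finset.range T, movement G η α β t j ^ 2 -
      23 / 100 * ∑ t ∈ Finset.range T, movement G η α β t i ^ 2 := by
  -- The initial variation is `2`, since there is no utility before the first round and corrected
  -- utilities are at most `2` in absolute value.
  let w : ℕ → ℝ := fun t => Nat.casesOn t 2 fun t =>
    2 * L * ∑ j, movement G η α β t j + movement G η α β t i
  have h := potential_le (α := α) (η := η) (β := β) hd hη (by linarith) hβ hα hα'
    (U := fun t => (selfPlay G η α β t i).cumulative) (v := fun t => (selfPlay G η α β t i).last)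
    (w := w) rfl rfl (fun t => cumulative_succ G η α β t i)
    (fun t => sum_play_mul_last G η α β hd t i) (fun t k => by
      cases t with
      | zero =>
        change |_ - (0 : ℝ)| ≤ 2
        rw [sub_zero]
        exact abs_last_le η α β hG hd 0 i k
      | succ t => exact abs_last_sub_le η α β hG hL hd t i k) T
  rw [potential_zero (by linarith) hd, Finset.sum_range_succ'] at h
  change _ ≤ _ + 27 / 8 * η ^ 2 * (∑ t ∈ Finset.range T,
    (2 * L * ∑ j, movement G η α β t j + movement G η α β t i) ^ 2 + 2 ^ 2) -
    4 / 17 * ∑ t ∈ Finset.range T, movement G η α β t i ^ 2 at h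
  have hw : ∑ t ∈ Finset.range T,
      (2 * L * ∑ j, movement G η α β t j + movement G η α β t i) ^ 2 ≤
      8 * L ^ 2 * n * ∑ j, ∑ t ∈ Finset.range T, movement G η α β t j ^ 2 +
        2 * ∑ t ∈ Finset.range T, movement G η α β t i ^ 2 := by
    rw [Finset.sum_comm, Finset.mul_sum, Finset.mul_sum, ← Finset.sum_add_distrib]
    refine Finset.sum_le_sum fun t _ => ?_
    have hcs := sq_sum_le_card_mul_sum_sq (s := Finset.univ) (f := fun j => movement G η α β t j)
    rw [Finset.card_univ, Fintype.card_fin] at hcs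
    have := mul_le_mul_of_nonneg_left hcs (by positivity : 0 ≤ 8 * L ^ 2)
    nlinarith [sq_nonneg (2 * L * ∑ j, movement G η α β t j - movement G η α β t i)]
  -- This makes the first-round term `27 / 2 * η ^ 2` at most `1 / 100` and leaves `4 / 17 - 27 / 4
  -- * η ^ 2 ≥ 23 / 100`.
  have hη2 : η ^ 2 ≤ 1 / 2500 := by nlinarith
  have hP : 0 ≤ ∑ t ∈ Finset.range T, movement G η α β t i ^ 2 :=
    Finset.sum_nonneg fun _ _ => sq_nonneg _
  have h1 := mul_le_mul_of_nonneg_left hw (by positivity : 0 ≤ 27 / 8 * η ^ 2)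
  have h2 := mul_le_mul_of_nonneg_right hη2 hP
  linarith

/-- The total movement of all strategies in self-play is bounded. -/
theorem sum_movement_le (hG : G.IsBounded) {L : ℝ} (hL : G.IsSmooth L)
    (hd : 1 ≤ d) (hη : 0 < η) (hη1 : η ≤ 1 / 50) (hηL : 288 * (η * L * n) ^ 2 ≤ 1) (hβ : 1 ≤ β)
    (hα : 2 + Real.log d + β * Real.log d ^ 2 ≤ α) (hα' : 18 + 17 * Real.log d ^ 2 ≤ α)
    (T : ℕ) :
    ∑ j, ∑ t ∈ Finset.range T, movement G η α β t j ^ 2 ≤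
      8 * n * ((α - 1) * Real.log (T + 1) + Real.log d + 1) := by
  set P := ∑ j, ∑ t ∈ Finset.range T, movement G η α β t j ^ 2 with hP
  have hP0 : 0 ≤ P := Finset.sum_nonneg fun _ _ => Finset.sum_nonneg fun _ _ => sq_nonneg _
  have hT0 : (0 : ℝ) < (T : ℝ) + 1 := by positivity
  have hi : ∀ i, 23 / 100 * ∑ t ∈ Finset.range T, movement G η α β t i ^ 2 ≤
      ((α - 1) * Real.log (T + 1) + Real.log d + 1 / 20) + 27 * η ^ 2 * L ^ 2 * n * P := by
    intro i
    have h1 := potential_selfPlay_le hG hL hd hη hη1 hβ hα hα' T i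
    -- At this rate even a regret of `-2 * (T + 1)` costs only `2 * η`, while the logarithmic term
    -- costs `(α - 1) * log (T + 1)`. This is the source of the `log T` factor.
    have hl : η / (T + 1) ∈ Set.Ioc 0 η :=
      ⟨by positivity, div_le_self hη.le (by linarith [(Nat.cast_nonneg T : (0:ℝ) ≤ T)])⟩
    have h2 := le_potential hd hη (by linarith) hβ hα
      (selfPlay G η α β (T + 1) i).cumulative ⟨0, hd⟩ hl
    have h3 := neg_two_mul_le_cumulative η α β hG hd (T + 1) i ⟨0, hd⟩
    have h4 := mul_le_mul_of_nonneg_left h3 hl.1.le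
    have h5 : η / (T + 1) * -(2 * ((T + 1 : ℕ) : ℝ)) = -(2 * η) := by
      push_cast; field_simp
    rw [h5] at h4
    rw [Real.log_div hη.ne' hT0.ne'] at h2
    linarith
  have hsum := Finset.sum_le_sum fun i (_ : i ∈ Finset.univ) => hi i
  rw [← Finset.mul_sum, ← hP, Finset.sum_const, Finset.card_univ, Fintype.card_fin,
    nsmul_eq_mul] at hsum
  have h6 := mul_le_mul_of_nonneg_right hηL hP0
  -- The step size lets the summed variation be absorbed: `23 / 100 - 27 / 288 ≥ 1 / 8`, hence the
  -- factor `8`.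
  have h7 : (n : ℝ) * (27 * η ^ 2 * L ^ 2 * n * P) ≤ 27 / 288 * P := by nlinarith
  have h8 : (0 : ℝ) ≤ n := Nat.cast_nonneg n
  have h9 : 0 ≤ (α - 1) * Real.log (T + 1) + Real.log d := by
    have := Real.log_nonneg (by exact_mod_cast hd : (1:ℝ) ≤ d)
    have : 0 ≤ Real.log ((T : ℝ) + 1) :=
      Real.log_nonneg (by linarith [(Nat.cast_nonneg T : (0:ℝ) ≤ T)])
    have : 0 ≤ α - 1 := by nlinarith [sq_nonneg (Real.log d)]
    positivity
  have h10 := mul_nonneg h8 h9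
  nlinarith

/-- The regret of every player in self-play. -/
theorem cumulative_le (hG : G.IsBounded) {L : ℝ} (hL0 : 0 < L) (hL : G.IsSmooth L)
    (hd : 1 ≤ d) (hη : 0 < η) (hη1 : η ≤ 1 / 50) (hηL : 288 * (η * L * n) ^ 2 ≤ 1)
    (hηinv : 1 ≤ η * (50 * (max 1 L * n))) (hβ : 1 ≤ β)
    (hα : 2 + Real.log d + β * Real.log d ^ 2 ≤ α) (hα' : 18 + 17 * Real.log d ^ 2 ≤ α)
    (T : ℕ) (i : Fin n) (a : Fin d) :
    (selfPlay G η α β (T + 1) i).cumulative a ≤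
      64 * (max 1 L * n) * ((α - 1) * Real.log (T + 1) + Real.log d + 1) := by
  have h1 := potential_selfPlay_le hG hL hd hη hη1 hβ hα hα' T i
  have h2 := le_potential hd hη (by linarith) hβ hα
      (selfPlay G η α β (T + 1) i).cumulative a ⟨hη, le_rfl⟩
  have h3 := sum_movement_le hG hL hd hη hη1 hηL hβ hα hα' T
  have hPi : 0 ≤ ∑ t ∈ Finset.range T, movement G η α β t i ^ 2 :=
    Finset.sum_nonneg fun _ _ => sq_nonneg _
  have hld := Real.log_nonneg (by exact_mod_cast hd : (1:ℝ) ≤ d)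
  have hB : Real.log d + 1 ≤ (α - 1) * Real.log (T + 1) + Real.log d + 1 := by
    have : 0 ≤ Real.log ((T : ℝ) + 1) :=
      Real.log_nonneg (by linarith [(Nat.cast_nonneg T : (0:ℝ) ≤ T)])
    have : 0 ≤ α - 1 := by nlinarith [sq_nonneg (Real.log d)]
    have : 0 ≤ (α - 1) * Real.log (T + 1) := by positivity
    linarith
  set B := (α - 1) * Real.log (T + 1) + Real.log d + 1
  have hB0 : 0 ≤ B := by linarith
  have hM : L * n ≤ max 1 L * n := mul_le_mul_of_nonneg_right (le_max_right _ _) (Nat.cast_nonneg n)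
  set M := max 1 L * n
  have hLn : 0 ≤ L * n := by positivity
  have hηLn : η * (L * n) ≤ 1 / 16 := by nlinarith [mul_nonneg hη.le hLn]
  -- One factor `η` is kept to be cancelled at the end; the other meets `L * n` and gives `216 / 16
  -- = 27 / 2`. With the `50` of `h9` the total stays below `64`.
  have h4 : 27 * η ^ 2 * L ^ 2 * n * ∑ j, ∑ t ∈ Finset.range T, movement G η α β t j ^ 2 ≤
      η * (27 / 2 * M * B) := by
    have h5 := mul_le_mul_of_nonneg_left h3 (by positivity : 0 ≤ 27 * η ^ 2 * L ^ 2 * n)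
    refine h5.trans ?_
    have h6 : 27 * η ^ 2 * L ^ 2 * n * (8 * n * B) =
        η * (216 * ((η * (L * n)) * (L * n)) * B) := by ring
    rw [h6]
    have h7 : (η * (L * n)) * (L * n) ≤ 1 / 16 * M := mul_le_mul hηLn hM hLn (by norm_num)
    have h8 : 216 * ((η * (L * n)) * (L * n)) ≤ 27 / 2 * M := by linarith
    gcongr
  have h9 : Real.log d + 1 / 100 ≤ η * (50 * M * B) := by
    have := mul_le_mul_of_nonneg_right hηinv hB0
    linarith
  have hMB : 0 ≤ M * B := by
    have : 0 ≤ M := hLn.trans hM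
    positivity
  refine le_of_mul_le_mul_left ?_ hη
  have := mul_nonneg hη.le hMB
  linarith

end SelfPlay

end DLRC

/-! ### Choice of constants. -/

theorem mainTheorem9 (β : ℝ) (hβ : 70 ≤ β) :
    ∃ C : ℝ, 0 < C ∧
      ∀ (n d : ℕ), 1 ≤ n → 2 ≤ d →
        ∀ G : NormalFormGame n d, G.IsBounded →
          G.IsSmooth 1 ∧
          ∀ L : ℝ, 0 < L → G.IsSmooth L →
            ∀ T : ℕ, 2 ≤ T →
              G.IsApproxCCE
                (C * max 1 L * (n * Real.log d ^ 2 * Real.log T / T))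
                (DLRC.empiricalPlay G (DLRC.eta L n) (DLRC.alpha β d) β T) := by
  refine ⟨64 * (17 + β), by linarith, fun n d hn hd G hG => ⟨hG.isSmooth_one, ?_⟩⟩
  intro L hL0 hL T hT
  have hn0 : (0 : ℝ) < n := by exact_mod_cast hn
  have hn1 : (1 : ℝ) ≤ n := by exact_mod_cast hn
  have hT0 : (0 : ℝ) < T := by positivity
  have hl2 : (69 : ℝ) / 100 ≤ Real.log 2 := by linarith [Real.log_two_gt_d9]
  have hld : (69 : ℝ) / 100 ≤ Real.log d :=
    hl2.trans (Real.log_le_log two_pos (by exact_mod_cast hd))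
  have hlT : (69 : ℝ) / 100 ≤ Real.log T :=
    hl2.trans (Real.log_le_log two_pos (by exact_mod_cast hT))
  have hs2 : (0 : ℝ) < Real.sqrt 2 := by positivity
  have hss : Real.sqrt 2 ^ 2 = 2 := Real.sq_sqrt (by norm_num)
  have hden : 0 < 12 * Real.sqrt 2 * L * n := by positivity
  have hη : 0 < DLRC.eta L n := lt_min (by norm_num) (by positivity)
  have hη1 : DLRC.eta L n ≤ 1 / 50 := min_le_left _ _
  have hηL : 288 * (DLRC.eta L n * L * n) ^ 2 ≤ 1 := by
    have h1 : DLRC.eta L n * (12 * Real.sqrt 2 * L * n) ≤ 1 := by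
      rw [← le_div_iff₀ hden]; exact min_le_right _ _
    have h2 := pow_le_pow_left₀ (by positivity) h1 2
    have h3 : (DLRC.eta L n * (12 * Real.sqrt 2 * L * n)) ^ 2 =
        144 * Real.sqrt 2 ^ 2 * (DLRC.eta L n * L * n) ^ 2 := by ring
    rw [h3, hss] at h2
    linarith
  have hηinv : 1 ≤ DLRC.eta L n * (50 * (max 1 L * n)) := by
    have hM1 : (1 : ℝ) ≤ max 1 L * n := by nlinarith [le_max_left 1 L]
    have hML : L * n ≤ max 1 L * n := mul_le_mul_of_nonneg_right (le_max_right _ _) hn0.le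
    rcases min_choice (1 / 50 : ℝ) (1 / (12 * Real.sqrt 2 * L * n)) with h | h
    · rw [DLRC.eta, h]; linarith
    · rw [DLRC.eta, h, one_div_mul_eq_div, le_div_iff₀ hden, one_mul]
      have : Real.sqrt 2 ≤ 2 := by nlinarith
      have h1 : Real.sqrt 2 * (L * n) ≤ 2 * (L * n) :=
        mul_le_mul_of_nonneg_right this (by positivity)
      have h2 : 0 < L * n := by positivity
      nlinarith
  -- As `log d ≥ 0.69`, lower-order terms are absorbed into `log² d`. With `β ≥ 70` this yields `18
  -- + 17 log² d ≤ α`, the margin of `α` over `V`.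
  have hsq : (1 : ℝ) ≤ 3 * Real.log d ^ 2 := by nlinarith
  have hlin : Real.log d ≤ 2 * Real.log d ^ 2 := by nlinarith
  have hβsq : 70 * Real.log d ^ 2 ≤ β * Real.log d ^ 2 := by gcongr
  refine DLRC.isApproxCCE_empiricalPlay G _ _ _ (by omega) (by omega) fun i a => ?_
  obtain ⟨T, rfl⟩ : ∃ S, T = S + 1 := ⟨T - 1, by omega⟩
  have h := DLRC.cumulative_le (α := DLRC.alpha β d) (β := β) hG hL0 hL (by omega) hη hη1 hηL
    hηinv (by linarith) (by rw [DLRC.alpha]; linarith) (by rw [DLRC.alpha]; linarith) T i a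
  refine h.trans ?_
  have e : ((T + 1 : ℕ) : ℝ) * (64 * (17 + β) * max 1 L *
      (n * Real.log d ^ 2 * Real.log (T + 1 : ℕ) / (T + 1 : ℕ))) =
      64 * (max 1 L * n) * ((17 + β) * Real.log d ^ 2 * Real.log (T + 1 : ℕ)) := by
    field_simp
  rw [e]
  push_cast at hlT ⊢
  refine mul_le_mul_of_nonneg_left ?_ (by positivity)
  -- The `17 + β` in the constant is this `7 + β` plus the `10` from `h2`, where `log d + 1 ≤ 5 log²
  -- d` and the logarithm of the number of rounds is at least `1 / 2`.
  have hα : DLRC.alpha β d - 1 ≤ (7 + β) * Real.log d ^ 2 := by rw [DLRC.alpha]; linarith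
  have h1 := mul_le_mul_of_nonneg_right hα (by linarith : 0 ≤ Real.log ((T : ℝ) + 1))
  have h2 : 5 * Real.log d ^ 2 ≤ 10 * Real.log d ^ 2 * Real.log ((T : ℝ) + 1) := by nlinarith
  linarith
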